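/- Let $n\ge 0$ be an integer. For $j\ge 0$ let $\hat p_j$ be the Legendre polynomial of degree $j$ that is orthonormal on $[-1,1]$ and has positive leading coefficient, i.e. $\hat p_j(t)=\sqrt{\tfrac{2j+1}{2}}\;{}_2F_1\!\left(-j,\,j+1;\,1;\,\tfrac{1-t}{2}\right)$, and put $\phi_j(t)=\hat p_j(2t-1)\,\chi_{[0,1)}(t)$. Write $(a)_k=a(a+1)\cdots(a+k-1)$, $(a)_0=1$. For $0\le i\le N$ with $i=0$ or $i$ odd, and $0\le k\le N$, let $$d^i_{N,k}=(-1)^N\frac{\sqrt{2N-2i+1}}{(-N)_i}\,\frac{(-N)_k(N-i+1)_k}{(1)_k(1)_k}\prod_{m=0}^{\frac{i-1}{2}}(N+k+1-2m)\prod_{m=0}^{\frac{i-3}{2}}(N-k-1-2m),$$ where empty products equal $1$ (in particular both products equal $1$ for $i=0$). For $0\le i\le n$ define $h^n_{n-i}$ on $[-1,1)$ by $$h^n_{n-i}(t)=\sum_{k=0}^{n}d^i_{n,k}t^k\ \ (i=0\text{ or } i\text{ odd}),\qquad h^n_{n-i}(t)=\sum_{k=0}^{n-1}d^{i-1}_{n-1,k}t^k\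 \ (i>0\text{ even})\qquad\text{for }0\le t<1,$$ and by $h^n_j(t)=(-1)^{j+1}h^n_j(-t)$ for $-1\le t<0$, where the value of $h^n_j(-t)$ is that of the polynomial above, also at $t=-1$. For $0\le j\le n$ put $\psi^n_j(t)=h^n_j(2t-1)\,\chi_{[0,1)}(t)$. Then the functions $$\sqrt2\,\phi_j\ \ (0\le j\le n),\qquad 2^{k/2}\,\psi^n_j(2^k\,\cdot\,-i)\ \ (k=0,1,2,\dots;\ 0\le i\le 2^k-1;\ 0\le j\le n)$$ are piecewise polynomial of degree at most $n$ on $[0,1)$ (with finitely many pieces each) and form an orthonormal basis of the Hilbert space $L^2[0,1)$, with real or with complex scalars. -/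

import Mathlib

open MeasureTheory

noncomputable section

namespace AlpertWavelet

/-- The Pochhammer symbol `(a)_k = a (a+1) ⋯ (a+k-1)`, with `(a)_0 = 1`. -/
def poch (a : ℝ) (k : ℕ) : ℝ := (ascPochhammer ℝ k).eval a

/-- The Legendre polynomial `p̂_j` of degree `j`, orthonormal on `[-1,1]`, with positive leading
coefficient: `p̂_j(t) = √(2j+1)/√2 · ₂F₁(-j, j+1; 1; (1-t)/2)`. The shifted Legendre polynomial
`∑ k ≤ j, (-1)^k C(j,k) C(j+k,j) x^k` is `₂F₁(-j, j+1; 1; x)`. -/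
def legendreHat (j : ℕ) (t : ℝ) : ℝ :=
  √(2 * j + 1) / √2 * Polynomial.aeval ((1 - t) / 2) (Polynomial.shiftedLegendre j)

/-- The scaling function `φ_j(t) = p̂_j(2t-1) χ_{[0,1)}(t)`. -/
def phi (j : ℕ) : ℝ → ℝ := (Set.Ico 0 1).indicator fun t => legendreHat j (2 * t - 1)

/-- The coefficient `d^i_{n,k}`, used for `i ≤ n` with `i = 0` or `i` odd. The two products run
over `0 ≤ m ≤ (i-1)/2` and `0 ≤ m ≤ (i-3)/2` and are empty for `i = 0`. -/
def dCoeff (n i k : ℕ) : ℝ :=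
  (-1) ^ n * (√(2 * n - 2 * i + 1) / poch (-n) i)
    * (poch (-n) k * poch (n - i + 1) k / (poch 1 k * poch 1 k))
    * (∏ m ∈ Finset.range ((i + 1) / 2), ((n : ℝ) + k + 1 - 2 * m))
    * ∏ m ∈ Finset.range ((i - 1) / 2), ((n : ℝ) - k - 1 - 2 * m)

/-- The polynomial with which `h^n_j` agrees on `[0,1)`; here `i = n - j` and `j ≤ n`. -/
def hRight (n j : ℕ) (t : ℝ) : ℝ :=
  if n - j = 0 ∨ Odd (n - j) then
    ∑ k ∈ Finset.range (n + 1), dCoeff n (n - j) k * t ^ k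
  else
    ∑ k ∈ Finset.range n, dCoeff (n - 1) (n - j - 1) k * t ^ k

/-- The function `h^n_j` on `[-1,1)`: given by `hRight` on `[0,1)`, and extended to `[-1,0)` by the
symmetry `h^n_j(-t) = (-1)^(j+1) h^n_j(t)`. -/
def h (n j : ℕ) (t : ℝ) : ℝ :=
  if 0 ≤ t then hRight n j t else (-1) ^ (j + 1) * hRight n j (-t)

/-- The wavelet `ψ^n_j(t) = h^n_j(2t-1) χ_{[0,1)}(t)`. -/
def psi (n j : ℕ) : ℝ → ℝ := (Set.Ico 0 1).indicator fun t => h n j (2 * t - 1)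

/-- Indices: `Sum.inl j` is the scaling function number `j`, and `Sum.inr ⟨k, i, j⟩` is the wavelet
number `j` at level `k ≥ 0` and position `i ∈ {0, …, 2^k - 1}`; in both cases `0 ≤ j ≤ n`. -/
abbrev Index (n : ℕ) : Type := Fin (n + 1) ⊕ (Σ k : ℕ, Fin (2 ^ k) × Fin (n + 1))

/-- The family `√2 φ_j`, `2^{k/2} ψ^n_j(2^k · - i)`. -/
def family (n : ℕ) : Index n → ℝ → ℝ
  | Sum.inl j => fun t => √2 * phi j t
  | Sum.inr ⟨k, i, j⟩ => fun t => (2 : ℝ) ^ ((k : ℝ) / 2) * psi n j (2 ^ k * t - ((i : ℕ) : ℝ))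

/-- `f` is piecewise polynomial of degree at most `n` on `[0,1)`: there are points
`0 = x_0 < x_1 < ⋯ < x_N = 1` such that `f` is a polynomial of degree at most `n` on each
`[x_m, x_{m+1})`. -/
def IsPiecewisePolynomial (n : ℕ) (f : ℝ → ℝ) : Prop :=
  ∃ (N : ℕ) (x : Fin (N + 1) → ℝ), StrictMono x ∧ x 0 = 0 ∧ x (Fin.last N) = 1 ∧
    ∀ m : Fin N, ∃ p : Polynomial ℝ, p.natDegree ≤ n ∧
      ∀ t ∈ Set.Ico (x m.castSucc) (x m.succ), f t = p.eval t

/-- Lebesgue measure on `[0,1)`. -/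
abbrev unitMeasure : Measure ℝ := volume.restrict (Set.Ico 0 1)

end AlpertWavelet

end

/-!
The polynomial `rightPoly n j`, with which `h^n_j` agrees on `[0,1)`, has coefficients
`(-1)^k C(N,k) r(k)`, up to a constant, with `N = n` or `n - 1` and a polynomial `r` of degree `N`.
By partial fractions its moment `∫₀¹ t^s h^n_j(t) dt` is, up to a nonzero factor, `r(-s-1)`
(`sum_dCoeff_div`), so that coefficients and moments are both products whose zeros can be read off. The
coefficients vanish for `k > j` of the parity of `j`; the moments vanish for `s < j`, and for all
`s ≤ n` of the parity opposite to `j`.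

Consequently `∫₀¹ h^n_j h^n_{j'}`, written as a sum of coefficients times moments, is zero for `j ≠ j'`
of equal parity, and has a single term for `j = j'`, which is `1` (`ip_rightPoly`). For `j`, `j'` of
different parity the integral over `[-1,1)` vanishes by symmetry. Together with the symmetry, the moments
show that `ψ^n_j` is orthogonal to all polynomials of degree at most `n` (`setIntegral_eval_mul_psi`).
Orthonormality of the whole family follows by scaling: each member is a single polynomial on the
support of any wavelet of a finer level.

For completeness, the triangular shape of the coefficients shows that the `ψ^n_j` and the polynomials
together span the functions that are polynomial of degree at most `n` on each half of `[0,1)`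
(`twoPiece_mem`). So a function in `L²[0,1)` orthogonal to the family is, level by level, orthogonal to
the polynomials on every dyadic interval (`indicator_eval_mem_annihilator`). In particular its
integrals over dyadic intervals vanish, and it is zero almost everywhere
(`ae_eq_zero_of_forall_dyadic`).
-/

noncomputable section

namespace AlpertWavelet

open Polynomial Finset

/-! ### Moments of the coefficient sequences -/

/-- The partial fraction expansion of `N! r(-x) / (x)_{N+1}`, read off from Lagrange interpolation of
`r` at the nodes `0, …, N`. -/
theorem sum_choose_div_add {N : ℕ} {r : ℝ[X]} (hr : r.natDegree ≤ N) {x : ℝ} (hx : 0 < x) :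
    ∑ k ∈ range (N + 1), (-1) ^ k * (N.choose k : ℝ) * r.eval (k : ℝ) / (x + k) =
      (N.factorial : ℝ) * r.eval (-x) / ∏ m ∈ range (N + 1), (x + m) := by
  have hinj : Set.InjOn (fun k : ℕ => (k : ℝ)) (range (N + 1)) :=
    fun a _ b _ hab => by simpa using hab
  have hdeg : r.degree < #(range (N + 1)) := by
    rw [card_range]
    exact degree_le_natDegree.trans_lt (by exact_mod_cast Nat.lt_succ_of_le hr)
  -- The barycentric weights of the nodes `0, …, N` are signed binomial coefficients.
  have hw : ∀ k ∈ range (N + 1), Lagrange.nodalWeight (range (N + 1)) (fun k : ℕ => (k : ℝ)) k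
      = (-1) ^ N * ((-1) ^ k * N.choose k) / N.factorial := by
    intro k hk
    have hk' : k ≤ N := by simpa [Nat.lt_succ_iff] using hk
    obtain ⟨l, rfl⟩ := Nat.exists_eq_add_of_le hk'
    have hprod : ∏ j ∈ (range (k + l + 1)).erase k, ((k : ℝ) - j) =
        k.factorial * ((-1) ^ l * l.factorial) := by
      have hs : (range (k + l + 1)).erase k = range k ∪ (range l).image (fun m => k + 1 + m) := by
        ext j
        simp only [mem_erase, mem_range, mem_union, mem_image]
        constructor
        · intro h
          by_cases hj : j < k
          · exact Or.inl hj
          · exact Or.inr ⟨j - k - 1, by omega, by omega⟩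
        · rintro (h | ⟨m, hm, rfl⟩) <;> omega
      rw [hs, prod_union, prod_image]
      · congr 1
        · rw [← prod_range_reflect, ← prod_range_add_one_eq_factorial]
          push_cast
          refine prod_congr rfl fun j hj => ?_
          have : j < k := by simpa using hj
          rw [Nat.sub_sub, Nat.cast_sub (by omega)]
          push_cast; ring
        · rw [← prod_range_add_one_eq_factorial]
          push_cast
          rw [← card_range l, ← prod_const, card_range, ← prod_mul_distrib]
          exact prod_congr rfl fun j _ => by ring
      · intro a _ b _ hab
        simpa using hab
      · rw [disjoint_left]
        intro j hj hj'
        simp only [mem_range, mem_image] at hj hj'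
        obtain ⟨m, _, rfl⟩ := hj'
        omega
    rw [Lagrange.nodalWeight, prod_inv_distrib, hprod]
    have hch : ((k + l).choose k : ℝ) = (k + l).factorial / (k.factorial * l.factorial) := by
      rw [Nat.cast_choose ℝ (by omega)]; simp
    have h1 : ((-1 : ℝ) ^ l) * (-1) ^ l = 1 := by rw [← mul_pow]; simp
    have h2 : ((-1 : ℝ) ^ k) * (-1) ^ k = 1 := by rw [← mul_pow]; simp
    have : ((k + l).factorial : ℝ) ≠ 0 := by positivity
    have : (k.factorial : ℝ) ≠ 0 := by positivity
    have : (l.factorial : ℝ) ≠ 0 := by positivity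
    have : (-1 : ℝ) ^ l ≠ 0 := by simp
    rw [hch, pow_add]
    field_simp
    linear_combination (-1 : ℝ) * h1 * (-1) ^ k * (-1) ^ k - h2
  have hx' : ∀ k ∈ range (N + 1), -x ≠ ((k : ℕ) : ℝ) := fun k _ h => by
    have : (0 : ℝ) ≤ k := by positivity
    linarith
  have key := Lagrange.eval_interpolate_not_at_node (fun k : ℕ => r.eval (k : ℝ)) hx'
  rw [← Lagrange.eq_interpolate hinj hdeg, Lagrange.eval_nodal] at key
  have hP : ∏ i ∈ range (N + 1), (-x - (i : ℝ)) =
      (-1) ^ (N + 1) * ∏ m ∈ range (N + 1), (x + m) := by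
    conv_rhs => rw [← card_range (N + 1), ← prod_const, card_range, ← prod_mul_distrib]
    exact prod_congr rfl fun j _ => by ring
  have hpos : 0 < ∏ m ∈ range (N + 1), (x + m) := prod_pos fun m _ => by positivity
  rw [eq_div_iff hpos.ne', key, hP, sum_mul, mul_sum, mul_sum]
  refine sum_congr rfl fun k hk => ?_
  rw [hw k hk]
  have h1 : ((-1 : ℝ) ^ N) * (-1) ^ N = 1 := by rw [← mul_pow]; simp
  have : (N.factorial : ℝ) ≠ 0 := by positivity
  have : x + k ≠ 0 := by positivity
  rw [show -x - (k : ℝ) = -(x + k) by ring, inv_neg, pow_succ]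
  field_simp
  linear_combination (-(N.choose k : ℝ) * r.eval (k : ℝ)) * h1

/-- The two products in `dCoeff N i k`, as a polynomial in `k`. Its zeros, and those of its reflection
`k ↦ -1 - k`, have a fixed parity relative to `N`. -/
def parityFactor (N i : ℕ) : ℝ[X] :=
  (∏ m ∈ range ((i + 1) / 2), (X + C ((N : ℝ) + 1 - 2 * m))) *
    ∏ m ∈ range ((i - 1) / 2), (C ((N : ℝ) - 1 - 2 * m) - X)

/-- The polynomial `r` with `dCoeff N i k = dScale N i * (-1)^k * C(N,k) * r(k)`; it is
`(k+1)_{N-i} / (N-i)!` times `parityFactor N i`. -/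
def coeffPoly (N i : ℕ) : ℝ[X] :=
  C ((N - i).factorial : ℝ)⁻¹ * (ascPochhammer ℝ (N - i)).comp (X + 1) * parityFactor N i

/-- The part of `dCoeff N i k` that does not depend on `k`. -/
def dScale (N i : ℕ) : ℝ := (-1) ^ N * (√(2 * N - 2 * i + 1) / poch (-N) i)

theorem poch_neg_natCast (N k : ℕ) :
    poch (-(N : ℝ)) k = (-1) ^ k * (k.factorial * N.choose k) := by
  rw [poch, ascPochhammer_eval_neg_eq_descPochhammer, descPochhammer_eval_eq_descFactorial,
    Nat.descFactorial_eq_factorial_mul_choose]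
  push_cast
  rfl

theorem poch_natCast_add_one (a k : ℕ) :
    poch ((a : ℝ) + 1) k = (a + k).factorial / a.factorial := by
  have h := ascPochhammer_nat_eq_natCast_ascFactorial ℝ (a + 1) k
  push_cast at h
  rw [poch, h, eq_div_iff (by positivity), mul_comm]
  exact_mod_cast Nat.factorial_mul_ascFactorial a k

theorem dCoeff_eq {N i : ℕ} (hi : i ≤ N) (k : ℕ) :
    dCoeff N i k = dScale N i * ((-1) ^ k * N.choose k * (coeffPoly N i).eval (k : ℝ)) := by
  obtain ⟨a, rfl⟩ := Nat.exists_eq_add_of_le' hi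
  have h1 : ((a + i : ℕ) : ℝ) - i + 1 = (a : ℝ) + 1 := by push_cast; ring
  have h2 : poch 1 k = k.factorial := by
    have := poch_natCast_add_one 0 k
    simpa using this
  have h3 : (ascPochhammer ℝ a).eval ((k : ℝ) + 1) = (a + k).factorial / k.factorial := by
    rw [add_comm a]
    exact poch_natCast_add_one k a
  rw [dCoeff, h1, h2, poch_neg_natCast _ k, poch_natCast_add_one, dScale, coeffPoly,
    Nat.add_sub_cancel, parityFactor]
  simp only [eval_mul, eval_comp, eval_C, eval_add, eval_X, eval_one, h3, eval_prod, eval_sub]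
  have e1 : ∀ m : ℕ, (((a + i : ℕ) : ℝ) + k + 1 - 2 * m) = k + (((a + i : ℕ) : ℝ) + 1 - 2 * m) :=
    fun m => by ring
  have e2 : ∀ m : ℕ, (((a + i : ℕ) : ℝ) - k - 1 - 2 * m) = (((a + i : ℕ) : ℝ) - 1 - 2 * m) - k :=
    fun m => by ring
  simp only [e1, e2]
  have : (k.factorial : ℝ) ≠ 0 := by positivity
  have : (a.factorial : ℝ) ≠ 0 := by positivity
  field_simp

/-- The degree is `(N - i) + i`, just small enough for `sum_choose_div_add`. -/
theorem natDegree_coeffPoly_le {N i : ℕ} (hi : i ≤ N) (h : i = 0 ∨ Odd i) :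
    (coeffPoly N i).natDegree ≤ N := by
  have h1 : (∏ m ∈ range ((i + 1) / 2), (X + C ((N : ℝ) + 1 - 2 * m))).natDegree ≤ (i + 1) / 2 := by
    refine (natDegree_prod_le _ _).trans ?_
    refine (sum_le_sum fun m _ => natDegree_X_add_C _ |>.le).trans ?_
    simp
  have h2 : (∏ m ∈ range ((i - 1) / 2), (C ((N : ℝ) - 1 - 2 * m) - X)).natDegree ≤
      (i - 1) / 2 := by
    refine (natDegree_prod_le _ _).trans ?_
    refine (sum_le_sum fun m _ => (?_ : _ ≤ 1)).trans ?_
    · compute_degree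
    · simp
  have h3 : ((ascPochhammer ℝ (N - i)).comp (X + 1)).natDegree ≤ N - i := by
    refine natDegree_comp_le.trans ?_
    rw [ascPochhammer_natDegree]
    have : (X + 1 : ℝ[X]).natDegree ≤ 1 := by compute_degree
    nlinarith
  have h4 : (i + 1) / 2 + (i - 1) / 2 = i := by
    rcases h with rfl | ⟨l, rfl⟩ <;> omega
  rw [coeffPoly, parityFactor, mul_assoc]
  refine (natDegree_C_mul_le _ _).trans ?_
  refine natDegree_mul_le.trans ?_
  refine (add_le_add h3 (natDegree_mul_le.trans (add_le_add h1 h2))).trans ?_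
  omega

/-- Since `∫₀¹ t^s t^k dt = 1/(s+k+1)`, this evaluates the moment of order `s` of the polynomial with
coefficients `dCoeff N i k`: up to a nonzero factor it is `coeffPoly N i` at `-(s+1)`. -/
theorem sum_dCoeff_div {N i : ℕ} (hi : i ≤ N) (h : i = 0 ∨ Odd i) (s : ℕ) :
    ∑ k ∈ range (N + 1), dCoeff N i k / (s + k + 1) =
      dScale N i * (N.factorial * s.factorial / (s + N + 1).factorial *
        (coeffPoly N i).eval (-((s : ℝ) + 1))) := by
  have key := sum_choose_div_add (natDegree_coeffPoly_le hi h) (x := (s : ℝ) + 1) (by positivity)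
  have hprod : ∏ m ∈ range (N + 1), ((s : ℝ) + 1 + m) = (s + N + 1).factorial / s.factorial := by
    have h1 := Nat.factorial_mul_ascFactorial s (N + 1)
    rw [Nat.ascFactorial_eq_prod_range] at h1
    rw [eq_div_iff (by positivity), mul_comm, add_assoc s]
    exact_mod_cast h1
  rw [hprod] at key
  have h5 : ∀ k ∈ range (N + 1), dCoeff N i k / ((s : ℝ) + k + 1) = dScale N i *
      ((-1) ^ k * (N.choose k : ℝ) * (coeffPoly N i).eval (k : ℝ) / ((s : ℝ) + 1 + k)) := by
    intro k _
    rw [dCoeff_eq hi, mul_div_assoc]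
    ring_nf
  rw [sum_congr rfl h5, ← mul_sum, key]
  field_simp

theorem eval_coeffPoly_neg {N i : ℕ} (s : ℕ) :
    (coeffPoly N i).eval (-((s : ℝ) + 1)) =
      (-1) ^ (N - i) * s.choose (N - i) *
        ((∏ m ∈ range ((i + 1) / 2), ((N : ℝ) - s - 2 * m)) *
          ∏ m ∈ range ((i - 1) / 2), ((N : ℝ) + s - 2 * m)) := by
  have h1 : (ascPochhammer ℝ (N - i)).eval (-(s : ℝ)) =
      (-1) ^ (N - i) * ((N - i).factorial * s.choose (N - i)) := poch_neg_natCast s (N - i)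
  rw [coeffPoly, parityFactor]
  simp only [eval_mul, eval_comp, eval_C, eval_add, eval_X, eval_one, eval_prod, eval_sub]
  rw [show -((s : ℝ) + 1) + 1 = -(s : ℝ) by ring, h1]
  have e1 : ∀ m : ℕ, (-((s : ℝ) + 1) + ((N : ℝ) + 1 - 2 * m)) = (N : ℝ) - s - 2 * m :=
    fun m => by ring
  have e2 : ∀ m : ℕ, ((N : ℝ) - 1 - 2 * m - -((s : ℝ) + 1)) = (N : ℝ) + s - 2 * m :=
    fun m => by ring
  simp only [e1, e2]
  have : ((N - i).factorial : ℝ) ≠ 0 := by positivity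
  field_simp

theorem sum_dCoeff_div_eq_zero_of_lt {N i s : ℕ} (hi : i ≤ N) (h : i = 0 ∨ Odd i)
    (hs : s < N - i) : ∑ k ∈ range (N + 1), dCoeff N i k / (s + k + 1) = 0 := by
  rw [sum_dCoeff_div hi h, eval_coeffPoly_neg, Nat.choose_eq_zero_of_lt hs]
  simp

theorem sum_dCoeff_div_eq_zero_of_even {N i s : ℕ} (hi : i ≤ N) (h : Odd i)
    (hs : s ≤ N) (hp : Even (N + s)) :
    ∑ k ∈ range (N + 1), dCoeff N i k / (s + k + 1) = 0 := by
  by_cases hs' : s < N - i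
  · exact sum_dCoeff_div_eq_zero_of_lt hi (Or.inr h) hs'
  rw [sum_dCoeff_div hi (Or.inr h), eval_coeffPoly_neg]
  obtain ⟨l, rfl⟩ := h
  obtain ⟨c, hc⟩ := hp
  have : ∏ m ∈ range ((2 * l + 1 + 1) / 2), ((N : ℝ) - s - 2 * m) = 0 := by
    refine prod_eq_zero (i := (N - s) / 2) (by simp; omega) ?_
    have : N = s + 2 * ((N - s) / 2) := by omega
    have h2 : (N : ℝ) = s + 2 * (((N - s) / 2 : ℕ) : ℝ) := by exact_mod_cast this
    linarith
  rw [this]; simp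

/-- The second product of `dCoeff` kills the coefficients of index `N-1, N-3, …` above `N - i`. -/
theorem dCoeff_eq_zero {N i k : ℕ} (h : Odd i) (hk : N - i < k) (hkN : k < N)
    (hp : Odd (N + k)) : dCoeff N i k = 0 := by
  obtain ⟨l, rfl⟩ := h
  obtain ⟨c, hc⟩ := hp
  have : ∏ m ∈ range ((2 * l + 1 - 1) / 2), ((N : ℝ) - k - 1 - 2 * m) = 0 := by
    refine prod_eq_zero (i := (N - k - 1) / 2) (by simp; omega) ?_
    have : N = k + 1 + 2 * ((N - k - 1) / 2) := by omega
    have h2 : (N : ℝ) = k + 1 + 2 * (((N - k - 1) / 2 : ℕ) : ℝ) := by exact_mod_cast this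
    linarith
  rw [dCoeff, this, mul_zero]

/-- The two pairs of step-two products interleave to `(2l+1)!` and `(2a+2l+2)! / (2a+1)!`. With
`i = 2l+1` and `N = a+i`, they are the values of `parityFactor N i` at `a` and at `-(a+1)`. -/
theorem prod_parity (a l : ℕ) :
    (∏ m ∈ range (l + 1), (2 * (a : ℝ) + 2 * l + 2 - 2 * m)) *
      (∏ m ∈ range l, (2 * (l : ℝ) - 2 * m)) *
      ((∏ m ∈ range (l + 1), (2 * (l : ℝ) + 1 - 2 * m)) *
      ∏ m ∈ range l, (2 * (a : ℝ) + 2 * l + 1 - 2 * m)) * (2 * a + 1).factorial =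
    (2 * l + 1).factorial * (2 * a + 2 * l + 2).factorial := by
  induction l with
  | zero =>
    simp only [zero_add, prod_range_one, prod_range_zero, mul_zero, Nat.factorial_succ]
    push_cast
    ring_nf
  | succ l ih =>
    rw [show 2 * (l + 1) + 1 = (2 * l + 1) + 1 + 1 by ring,
      show 2 * a + 2 * (l + 1) + 2 = (2 * a + 2 * l + 2) + 1 + 1 by ring,
      Nat.factorial_succ (2 * l + 1 + 1), Nat.factorial_succ (2 * l + 1),
      Nat.factorial_succ (2 * a + 2 * l + 2 + 1), Nat.factorial_succ (2 * a + 2 * l + 2)]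
    have e1 : ∏ m ∈ range (l + 1 + 1), (2 * (a : ℝ) + 2 * ((l + 1 : ℕ) : ℝ) + 2 - 2 * m) =
        (2 * (a : ℝ) + 2 * l + 4) * ∏ m ∈ range (l + 1), (2 * (a : ℝ) + 2 * l + 2 - 2 * m) := by
      rw [prod_range_succ', mul_comm]
      push_cast
      ring_nf
    have e2 : ∏ m ∈ range (l + 1), (2 * ((l + 1 : ℕ) : ℝ) - 2 * m) =
        (2 * (l : ℝ) + 2) * ∏ m ∈ range l, (2 * (l : ℝ) - 2 * m) := by
      rw [prod_range_succ', mul_comm]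
      push_cast
      ring_nf
    have e3 : ∏ m ∈ range (l + 1 + 1), (2 * ((l + 1 : ℕ) : ℝ) + 1 - 2 * m) =
        (2 * (l : ℝ) + 3) * ∏ m ∈ range (l + 1), (2 * (l : ℝ) + 1 - 2 * m) := by
      rw [prod_range_succ', mul_comm]
      push_cast
      ring_nf
    have e4 : ∏ m ∈ range (l + 1), (2 * (a : ℝ) + 2 * ((l + 1 : ℕ) : ℝ) + 1 - 2 * m) =
        (2 * (a : ℝ) + 2 * l + 3) * ∏ m ∈ range l, (2 * (a : ℝ) + 2 * l + 1 - 2 * m) := by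
      rw [prod_range_succ', mul_comm]
      push_cast
      ring_nf
    rw [e1, e2, e3, e4]
    push_cast
    linear_combination (2 * (a : ℝ) + 2 * l + 4) * (2 * l + 2) * (2 * l + 3) *
      (2 * a + 2 * l + 3) * ih

/-- Coefficient times moment at index `N - i`, the only index at which both can be nonzero, so that
this is the squared norm of the polynomial. -/
theorem dCoeff_mul_sum_dCoeff_div {N i : ℕ} (hi : i ≤ N) (h : i = 0 ∨ Odd i) :
    dCoeff N i (N - i) * ∑ k ∈ range (N + 1), dCoeff N i k / ((N - i : ℕ) + k + 1) = 1 := by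
  rw [sum_dCoeff_div hi h, dCoeff_eq hi, eval_coeffPoly_neg]
  obtain ⟨a, rfl⟩ := Nat.exists_eq_add_of_le' hi
  rw [coeffPoly, parityFactor, dScale, poch_neg_natCast, Nat.add_sub_cancel]
  simp only [eval_mul, eval_comp, eval_C, eval_add, eval_X, eval_one, eval_prod, eval_sub]
  have h3 : (ascPochhammer ℝ a).eval ((a : ℝ) + 1) = (a + a).factorial / a.factorial :=
    poch_natCast_add_one a a
  have hs : √(2 * ((a + i : ℕ) : ℝ) - 2 * i + 1) * √(2 * ((a + i : ℕ) : ℝ) - 2 * i + 1) =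
      2 * a + 1 := by
    rw [Real.mul_self_sqrt] <;> push_cast
    · ring
    · ring_nf; positivity
  -- With `N = a + i`: the product of the values of `parityFactor N i` at `a` and at `-(a+1)`.
  have hQ : (∏ m ∈ range ((i + 1) / 2), ((a : ℝ) + (((a + i : ℕ) : ℝ) + 1 - 2 * m))) *
      (∏ m ∈ range ((i - 1) / 2), (((a + i : ℕ) : ℝ) - 1 - 2 * m - a)) *
      ((∏ m ∈ range ((i + 1) / 2), (((a + i : ℕ) : ℝ) - a - 2 * m)) *
      ∏ m ∈ range ((i - 1) / 2), (((a + i : ℕ) : ℝ) + a - 2 * m)) * (2 * a + 1).factorial =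
      i.factorial * (a + (a + i) + 1).factorial := by
    rcases h with rfl | ⟨l, rfl⟩
    · simp
      ring_nf
    · rw [show (2 * l + 1 + 1) / 2 = l + 1 by omega, show (2 * l + 1 - 1) / 2 = l by omega,
        show a + (a + (2 * l + 1)) + 1 = 2 * a + 2 * l + 2 by ring, ← prod_parity]
      push_cast
      ring_nf
  set A := ∏ m ∈ range ((i + 1) / 2), ((a : ℝ) + (((a + i : ℕ) : ℝ) + 1 - 2 * m))
  set B := ∏ m ∈ range ((i - 1) / 2), (((a + i : ℕ) : ℝ) - 1 - 2 * m - a)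
  set A' := ∏ m ∈ range ((i + 1) / 2), (((a + i : ℕ) : ℝ) - a - 2 * m)
  set B' := ∏ m ∈ range ((i - 1) / 2), (((a + i : ℕ) : ℝ) + a - 2 * m)
  set S := √(2 * ((a + i : ℕ) : ℝ) - 2 * i + 1)
  have hch : ((a + i).choose i : ℝ) = (a + i).factorial / (i.factorial * a.factorial) := by
    rw [Nat.cast_choose ℝ (by omega)]; simp
  have hch' : ((a + i).choose a : ℝ) = (a + i).factorial / (a.factorial * i.factorial) := by
    rw [Nat.cast_choose ℝ (by omega)]; simp
  have hf : (2 * a + 1).factorial = (2 * a + 1) * (a + a).factorial := by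
    rw [Nat.factorial_succ, two_mul]
  rw [hf] at hQ
  rw [h3, hch, hch', Nat.choose_self]
  push_cast at hQ ⊢
  have g1 : ((a + i).factorial : ℝ) ≠ 0 := by positivity
  have g2 : (a.factorial : ℝ) ≠ 0 := by positivity
  have g3 : (i.factorial : ℝ) ≠ 0 := by positivity
  have g4 : ((a + (a + i) + 1).factorial : ℝ) ≠ 0 := by positivity
  have g5 : ∀ j : ℕ, ((-1 : ℝ) ^ j) * (-1) ^ j = 1 := fun j => by rw [← mul_pow]; simp
  have g6 : (-1 : ℝ) ^ i ≠ 0 := by simp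
  have p1 : ((-1 : ℝ) ^ (a + i)) ^ 2 = 1 := by rw [sq, g5]
  have p2 : ((-1 : ℝ) ^ i) ^ 2 = 1 := by rw [sq, g5]
  have p3 : ((-1 : ℝ) ^ a) ^ 2 = 1 := by rw [sq, g5]
  have p4 : S ^ 2 = 2 * a + 1 := by rw [sq, hs]
  field_simp
  rw [p1, p2, p3, p4]
  linear_combination hQ

/-! ### The polynomials behind the wavelets -/

/-- The polynomial with coefficients `dCoeff N i k`, `0 ≤ k ≤ N`. -/
def wavePoly (N i : ℕ) : ℝ[X] := ∑ k ∈ range (N + 1), monomial k (dCoeff N i k)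

theorem coeff_wavePoly (N i k : ℕ) :
    (wavePoly N i).coeff k = if k ≤ N then dCoeff N i k else 0 := by
  simp [wavePoly, finsetSum_coeff, coeff_monomial]

theorem natDegree_wavePoly_le (N i : ℕ) : (wavePoly N i).natDegree ≤ N :=
  natDegree_le_iff_coeff_eq_zero.2 fun k hk => by simp [coeff_wavePoly, hk.not_ge]

theorem eval_wavePoly (N i : ℕ) (t : ℝ) :
    (wavePoly N i).eval t = ∑ k ∈ range (N + 1), dCoeff N i k * t ^ k := by
  simp [wavePoly, eval_finsetSum]

/-- The inner product `∫₀¹ p q` of two real polynomials. -/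
def ip (p q : ℝ[X]) : ℝ := ∫ t in (0 : ℝ)..1, p.eval t * q.eval t

theorem ip_comm (p q : ℝ[X]) : ip p q = ip q p := by simp [ip, mul_comm]

theorem ip_eq_sum {n : ℕ} (p : ℝ[X]) {q : ℝ[X]} (hq : q.natDegree ≤ n) :
    ip p q = ∑ s ∈ range (n + 1), q.coeff s * ip p (X ^ s) := by
  simp only [ip, eval_pow, eval_X]
  simp_rw [← intervalIntegral.integral_const_mul]
  rw [← intervalIntegral.integral_finsetSum]
  · refine intervalIntegral.integral_congr fun t _ => ?_
    rw [eval_eq_sum_range' (Nat.lt_succ_of_le hq), mul_sum]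
    exact sum_congr rfl fun s _ => by ring
  · intro s _
    exact Continuous.intervalIntegrable (by fun_prop) _ _

theorem ip_C_mul_C_mul (a b : ℝ) (p q : ℝ[X]) : ip (C a * p) (C b * q) = a * b * ip p q := by
  simp only [ip, eval_mul, eval_C, ← intervalIntegral.integral_const_mul]
  exact intervalIntegral.integral_congr fun t _ => by ring

theorem ip_X_pow_X_pow (k s : ℕ) : ip (X ^ k) (X ^ s) = 1 / ((k : ℝ) + s + 1) := by
  simp [ip, ← pow_add, integral_pow]

theorem ip_wavePoly_X_pow (N i s : ℕ) :
    ip (wavePoly N i) (X ^ s) = ∑ k ∈ range (N + 1), dCoeff N i k / (s + k + 1) := by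
  rw [ip_comm, ip_eq_sum _ (natDegree_wavePoly_le N i)]
  refine sum_congr rfl fun k hk => ?_
  have hk' : k ≤ N := by simpa [Nat.lt_succ_iff] using hk
  rw [coeff_wavePoly, if_pos hk', ip_X_pow_X_pow, mul_one_div]

/-- The polynomial behind `hRight n j`. -/
def rightPoly (n j : ℕ) : ℝ[X] :=
  if n - j = 0 ∨ Odd (n - j) then wavePoly n (n - j) else wavePoly (n - 1) (n - j - 1)

theorem hRight_eq_eval (n j : ℕ) (t : ℝ) : hRight n j t = (rightPoly n j).eval t := by
  unfold hRight rightPoly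
  split_ifs with h
  · rw [eval_wavePoly]
  · have : n - 1 + 1 = n := by omega
    rw [eval_wavePoly, this]

/-- For `j = n` this is the Legendre case. Odd and even `n - j > 0` are both covered by a `wavePoly N i`
with `i` odd and `N - i = j`, where `N` is `n` or `n - 1`. -/
theorem rightPoly_eq_wavePoly {n j : ℕ} (hj : j ≤ n) :
    (j = n ∧ rightPoly n j = wavePoly n 0) ∨
    ∃ N i, i ≤ N ∧ N ≤ n ∧ n ≤ N + 1 ∧ Odd i ∧ N - i = j ∧ rightPoly n j = wavePoly N i := by
  unfold rightPoly
  split_ifs with h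
  · rcases h with h | h
    · exact Or.inl ⟨by omega, by rw [h]⟩
    · exact Or.inr ⟨n, n - j, by omega, le_rfl, by omega, h, by omega, rfl⟩
  · rw [not_or, Nat.not_odd_iff_even] at h
    refine Or.inr ⟨n - 1, n - j - 1, by omega, by omega, by omega, ?_, by omega, rfl⟩
    exact Nat.Even.sub_odd (by omega) h.2 odd_one

theorem natDegree_rightPoly_le {n j : ℕ} (hj : j ≤ n) : (rightPoly n j).natDegree ≤ n := by
  obtain ⟨-, h⟩ | ⟨N, i, -, hN, -, -, -, h⟩ := rightPoly_eq_wavePoly hj <;> rw [h]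
  · exact natDegree_wavePoly_le n 0
  · exact (natDegree_wavePoly_le N i).trans hN

theorem ip_rightPoly_X_pow_of_lt {n j s : ℕ} (hj : j ≤ n) (hs : s < j) :
    ip (rightPoly n j) (X ^ s) = 0 := by
  obtain ⟨rfl, h⟩ | ⟨N, i, hi, -, -, hodd, rfl, h⟩ := rightPoly_eq_wavePoly hj <;>
    rw [h, ip_wavePoly_X_pow]
  · exact sum_dCoeff_div_eq_zero_of_lt (Nat.zero_le _) (Or.inl rfl) (by simpa using hs)
  · exact sum_dCoeff_div_eq_zero_of_lt hi (Or.inr hodd) hs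

theorem ip_rightPoly_X_pow_of_odd {n j s : ℕ} (hj : j ≤ n) (hs : s ≤ n) (hp : Odd (s + j)) :
    ip (rightPoly n j) (X ^ s) = 0 := by
  by_cases hlt : s < j
  · exact ip_rightPoly_X_pow_of_lt hj hlt
  obtain ⟨rfl, h⟩ | ⟨N, i, hi, hN, hN', hodd, rfl, h⟩ := rightPoly_eq_wavePoly hj
  · obtain ⟨c, hc⟩ := hp
    omega
  · rw [h, ip_wavePoly_X_pow]
    obtain ⟨c, hc⟩ := hp
    obtain ⟨l, hl⟩ := hodd
    by_cases hsN : s ≤ N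
    · exact sum_dCoeff_div_eq_zero_of_even hi ⟨l, hl⟩ hsN (by rw [Nat.even_iff]; omega)
    · omega

theorem coeff_rightPoly_eq_zero {n j k : ℕ} (hj : j ≤ n) (hk : j < k) (hp : Even (k + j)) :
    (rightPoly n j).coeff k = 0 := by
  obtain ⟨c, hc⟩ := hp
  obtain ⟨rfl, h⟩ | ⟨N, i, hi, hN, hN', ⟨l, hl⟩, rfl, h⟩ := rightPoly_eq_wavePoly hj <;>
    rw [h, coeff_wavePoly]
  · rw [if_neg (by omega)]
  · split_ifs with hkN
    · exact dCoeff_eq_zero ⟨l, hl⟩ hk (by omega) (by rw [Nat.odd_iff]; omega)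
    · rfl

theorem coeff_mul_ip_rightPoly_X_pow {n j : ℕ} (hj : j ≤ n) :
    (rightPoly n j).coeff j * ip (rightPoly n j) (X ^ j) = 1 := by
  obtain ⟨rfl, h⟩ | ⟨N, i, hi, hN, hN', hodd, rfl, h⟩ := rightPoly_eq_wavePoly hj <;>
    rw [h, coeff_wavePoly, ip_wavePoly_X_pow]
  · rw [if_pos le_rfl]
    exact dCoeff_mul_sum_dCoeff_div (Nat.zero_le j) (Or.inl rfl)
  · rw [if_pos (Nat.sub_le _ _)]
    exact dCoeff_mul_sum_dCoeff_div hi (Or.inr hodd)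

/-- Expand the polynomial of smaller index in monomials `X ^ s`. Each `s ≠ j'` drops out: for `s < j'`
or `s + j'` odd the moment vanishes, in the remaining case the coefficient does. -/
theorem ip_rightPoly {n j j' : ℕ} (hj : j ≤ n) (hj' : j' ≤ n) (hp : Even (j + j')) :
    ip (rightPoly n j) (rightPoly n j') = if j = j' then 1 else 0 := by
  wlog hle : j' ≤ j generalizing j j'
  · rw [ip_comm, this hj' hj (by rwa [add_comm]) (by omega)]
    simp only [eq_comm]
  rw [ip_eq_sum _ (natDegree_rightPoly_le hj')]
  have hz : ∀ s ∈ range (n + 1), s ≠ j' →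
      (rightPoly n j').coeff s * ip (rightPoly n j) (X ^ s) = 0 := by
    intro s hs hne
    have hs' : s ≤ n := by simpa [Nat.lt_succ_iff] using hs
    rcases Nat.even_or_odd (s + j') with he | ho
    · rcases lt_or_gt_of_ne hne with hlt | hgt
      · rw [ip_rightPoly_X_pow_of_lt hj (hlt.trans_le hle), mul_zero]
      · rw [coeff_rightPoly_eq_zero hj' hgt he, zero_mul]
    · rw [ip_rightPoly_X_pow_of_odd hj hs', mul_zero]
      rw [Nat.odd_iff] at ho ⊢
      rw [Nat.even_iff] at hp
      omega
  rw [sum_eq_single j' hz (fun h => absurd (by simp; omega) h)]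
  split_ifs with h
  · subst h
    exact coeff_mul_ip_rightPoly_X_pow hj
  · rw [ip_rightPoly_X_pow_of_lt hj (by omega), mul_zero]

/-- The scaling function number `j` is the case `n = j` of `h^n_j` on `[0,1)`: both are the Legendre
polynomial, as `i = n - j = 0`. -/
theorem sqrt_two_mul_legendreHat (j : ℕ) (t : ℝ) :
    √2 * legendreHat j (2 * t - 1) = (rightPoly j j).eval t := by
  have h1 : (1 - (2 * t - 1)) / 2 = 1 - t := by ring
  have h2 : √2 ≠ 0 := by positivity
  rw [legendreHat, h1, shiftedLegendre_eval_symm, sub_sub_cancel, rightPoly,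
    if_pos (Or.inl (Nat.sub_self j)), eval_wavePoly, Nat.sub_self, aeval_eq_sum_range,
    natDegree_shiftedLegendre]
  rw [show ∀ S : ℝ, √2 * (√(2 * j + 1) / √2 * ((-1) ^ j * S)) = (-1) ^ j * √(2 * j + 1) * S from
    fun S => by field_simp, mul_sum]
  refine sum_congr rfl fun k _ => ?_
  have h3 : poch ((j : ℝ) - (0 : ℕ) + 1) k = (j + k).factorial / j.factorial := by
    rw [Nat.cast_zero, sub_zero, poch_natCast_add_one]
  have h4 : poch 1 k = k.factorial := by
    have := poch_natCast_add_one 0 k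
    simpa using this
  have h5 : poch (-(j : ℝ)) 0 = 1 := by simp [poch]
  rw [dCoeff, h3, h4, h5, poch_neg_natCast, coeff_shiftedLegendre]
  have h6 : ((j + k).choose j : ℝ) = (j + k).factorial / (j.factorial * k.factorial) := by
    rw [Nat.cast_choose ℝ (by omega)]; simp
  have : (k.factorial : ℝ) ≠ 0 := by positivity
  simp only [zsmul_eq_mul]
  push_cast
  rw [h6]
  simp
  field_simp

/-! ### Two-piece polynomials -/

/-- The function on `[0,1)`, zero elsewhere, given in the variable `u = 2t - 1` by `A(-u)` for `u < 0`
and by `B(u)` for `u ≥ 0`. The reflection in the left half makes a function with the symmetry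
`f(-u) = ± f(u)` correspond to `A = ± B`. -/
def twoPiece (A B : ℝ[X]) : ℝ → ℝ :=
  (Set.Ico 0 1).indicator fun t => if t < 1 / 2 then A.eval (1 - 2 * t) else B.eval (2 * t - 1)

theorem twoPiece_of_lt (A B : ℝ[X]) {t : ℝ} (h0 : 0 ≤ t) (h1 : t < 1 / 2) :
    twoPiece A B t = A.eval (1 - 2 * t) := by
  have hm : t ∈ Set.Ico (0 : ℝ) 1 := ⟨h0, by linarith⟩
  rw [twoPiece, Set.indicator_of_mem hm, if_pos h1]

theorem twoPiece_of_ge (A B : ℝ[X]) {t : ℝ} (h0 : 1 / 2 ≤ t) (h1 : t < 1) :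
    twoPiece A B t = B.eval (2 * t - 1) := by
  have hm : t ∈ Set.Ico (0 : ℝ) 1 := ⟨by linarith, h1⟩
  rw [twoPiece, Set.indicator_of_mem hm, if_neg h0.not_gt]

theorem twoPiece_of_notMem (A B : ℝ[X]) {t : ℝ} (ht : t ∉ Set.Ico (0 : ℝ) 1) :
    twoPiece A B t = 0 :=
  Set.indicator_of_notMem ht _

theorem psi_eq_twoPiece (n j : ℕ) :
    psi n j = twoPiece (C ((-1) ^ (j + 1)) * rightPoly n j) (rightPoly n j) := by
  refine congrArg _ (funext fun t => ?_)
  by_cases ht : t < 1 / 2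
  · rw [if_pos ht, h, if_neg (by linarith), hRight_eq_eval, eval_mul, eval_C, neg_sub]
  · rw [if_neg ht, h, if_pos (by linarith), hRight_eq_eval]

theorem indicator_eval_eq_twoPiece (q : ℝ[X]) :
    (Set.Ico 0 1).indicator (fun t => q.eval t) =
      twoPiece ((q.comp (C (1 / 2) * (1 + X))).comp (-X)) (q.comp (C (1 / 2) * (1 + X))) := by
  refine congrArg _ (funext fun t => ?_)
  split_ifs <;> simp

theorem indicator_eval_comp_eq_twoPiece (q : ℝ[X]) :
    (Set.Ico 0 1).indicator (fun t => (q.comp (2 * X - 1)).eval t) =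
      twoPiece (q.comp (-X)) q := by
  refine congrArg _ (funext fun t => ?_)
  split_ifs <;> simp

theorem setIntegral_twoPiece_mul_twoPiece (A B A' B' : ℝ[X]) :
    ∫ t in Set.Ico 0 1, twoPiece A B t * twoPiece A' B' t = (ip A A' + ip B B') / 2 := by
  have hU : Set.Ico (0 : ℝ) 1 = Set.Ico 0 (1 / 2) ∪ Set.Ico (1 / 2) 1 := by
    rw [Set.Ico_union_Ico_eq_Ico] <;> norm_num
  have hd : Disjoint (Set.Ico (0 : ℝ) (1 / 2)) (Set.Ico (1 / 2) 1) := by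
    rw [Set.disjoint_left]
    rintro t ⟨-, ht⟩ ⟨ht', -⟩
    linarith
  have hL : Set.EqOn (fun t => twoPiece A B t * twoPiece A' B' t)
      (fun t => A.eval (1 - 2 * t) * A'.eval (1 - 2 * t)) (Set.Ico 0 (1 / 2)) := by
    rintro t ⟨ht, ht'⟩
    simp only [twoPiece_of_lt _ _ ht ht']
  have hR : Set.EqOn (fun t => twoPiece A B t * twoPiece A' B' t)
      (fun t => B.eval (2 * t - 1) * B'.eval (2 * t - 1)) (Set.Ico (1 / 2) 1) := by
    rintro t ⟨ht, ht'⟩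
    simp only [twoPiece_of_ge _ _ ht ht']
  have cL : IntegrableOn (fun t => A.eval (1 - 2 * t) * A'.eval (1 - 2 * t))
      (Set.Ico 0 (1 / 2)) :=
    (Continuous.integrableOn_Icc (by fun_prop)).mono_set Set.Ico_subset_Icc_self
  have cR : IntegrableOn (fun t => B.eval (2 * t - 1) * B'.eval (2 * t - 1))
      (Set.Ico (1 / 2) 1) :=
    (Continuous.integrableOn_Icc (by fun_prop)).mono_set Set.Ico_subset_Icc_self
  rw [hU, setIntegral_union hd measurableSet_Ico
    (cL.congr_fun hL.symm measurableSet_Ico) (cR.congr_fun hR.symm measurableSet_Ico),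
    setIntegral_congr_fun measurableSet_Ico hL, setIntegral_congr_fun measurableSet_Ico hR,
    integral_Ico_eq_integral_Ioc, integral_Ico_eq_integral_Ioc,
    ← intervalIntegral.integral_of_le (by norm_num),
    ← intervalIntegral.integral_of_le (by norm_num)]
  rw [intervalIntegral.integral_comp_sub_mul (fun u => A.eval u * A'.eval u) two_ne_zero,
    intervalIntegral.integral_comp_mul_sub (fun u => B.eval u * B'.eval u) two_ne_zero]
  norm_num [ip]
  ring

theorem setIntegral_psi_mul_psi {n j j' : ℕ} (hj : j ≤ n) (hj' : j' ≤ n) :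
    ∫ t in Set.Ico 0 1, psi n j t * psi n j' t = if j = j' then 1 else 0 := by
  rw [psi_eq_twoPiece, psi_eq_twoPiece, setIntegral_twoPiece_mul_twoPiece, ip_C_mul_C_mul,
    ← pow_add]
  rcases Nat.even_or_odd (j + j') with he | ho
  · rw [ip_rightPoly hj hj' he, Even.neg_one_pow (by rw [Nat.even_iff] at he ⊢; omega)]
    split_ifs <;> norm_num
  · rw [Odd.neg_one_pow (by rw [Nat.odd_iff] at ho ⊢; omega), if_neg]
    · ring
    · rintro rfl
      rw [Nat.odd_iff] at ho
      omega

theorem coeff_comp_neg_X (q : ℝ[X]) (s : ℕ) : (q.comp (-X)).coeff s = (-1) ^ s * q.coeff s := by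
  rw [show (-X : ℝ[X]) = C (-1) * X by simp, comp_C_mul_X_coeff, mul_comm]

/-- In the variable `u = 2t - 1`, the powers `u^s` of the parity opposite to that of `h^n_j` cancel by
symmetry, and those of the same parity have vanishing moment on `[0,1]`. -/
theorem setIntegral_eval_mul_psi {n j : ℕ} (hj : j ≤ n) {q : ℝ[X]} (hq : q.natDegree ≤ n) :
    ∫ t in Set.Ico 0 1, q.eval t * psi n j t = 0 := by
  have h1 : ∫ t in Set.Ico 0 1, q.eval t * psi n j t =
      ∫ t in Set.Ico 0 1, (Set.Ico 0 1).indicator (fun t => q.eval t) t * psi n j t :=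
    setIntegral_congr_fun measurableSet_Ico fun t ht => by
      simp only [Set.indicator_of_mem ht]
  rw [h1, indicator_eval_eq_twoPiece, psi_eq_twoPiece, setIntegral_twoPiece_mul_twoPiece]
  set Q := q.comp (C (1 / 2) * (1 + X))
  have hd : (C (1 / 2) * (1 + X) : ℝ[X]).natDegree ≤ 1 := by compute_degree
  have hd' : (-X : ℝ[X]).natDegree ≤ 1 := by compute_degree
  have hQ : Q.natDegree ≤ n := natDegree_comp_le.trans (by nlinarith)
  have hQ' : (Q.comp (-X)).natDegree ≤ n := natDegree_comp_le.trans (by nlinarith)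
  have h2 := ip_C_mul_C_mul 1 ((-1) ^ (j + 1)) (Q.comp (-X)) (rightPoly n j)
  rw [C_1, one_mul, one_mul] at h2
  rw [h2, ip_comm, ip_eq_sum _ hQ', ip_comm Q, ip_eq_sum _ hQ, mul_sum, ← sum_add_distrib,
    sum_eq_zero, zero_div]
  intro s hs
  have hs' : s ≤ n := by simpa [Nat.lt_succ_iff] using hs
  rw [coeff_comp_neg_X]
  rcases Nat.even_or_odd (s + j) with he | ho
  · have : (-1 : ℝ) ^ (j + 1) * (-1) ^ s = -1 := by
      rw [← pow_add, Odd.neg_one_pow]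
      rw [Nat.even_iff] at he
      rw [Nat.odd_iff]
      omega
    linear_combination Q.coeff s * ip (rightPoly n j) (X ^ s) * this
  · rw [ip_rightPoly_X_pow_of_odd hj hs' ho]
    ring

/-- Polynomials and wavelets of degree at most `n` span all functions that are polynomial on each half
of `[0,1)`. The statement about an arbitrary submodule `A` is what the completeness proof applies to
annihilators. -/
theorem twoPiece_mem {n : ℕ} {A : Submodule ℝ (ℝ → ℝ)}
    (hpoly : ∀ q : ℝ[X], q.natDegree ≤ n → (Set.Ico 0 1).indicator (fun t => q.eval t) ∈ A)
    (hpsi : ∀ j ≤ n, psi n j ∈ A) {p q : ℝ[X]} (hp : p.natDegree ≤ n) (hq : q.natDegree ≤ n) :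
    twoPiece p q ∈ A := by
  have hlin : ∀ (ι : Type) (s : Finset ι) (c : ι → ℝ) (P Q : ι → ℝ[X]),
      twoPiece (∑ i ∈ s, C (c i) * P i) (∑ i ∈ s, C (c i) * Q i) =
        ∑ i ∈ s, c i • twoPiece (P i) (Q i) := by
    intro ι s c P Q
    funext t
    simp only [twoPiece, Finset.sum_apply, Pi.smul_apply, smul_eq_mul, Set.indicator_apply]
    split_ifs <;> simp [eval_finsetSum]
  have hX : ∀ s ≤ n, twoPiece (C ((-1) ^ s) * X ^ s) (X ^ s) ∈ A := by
    intro s hs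
    have h1 := hpoly ((X ^ s : ℝ[X]).comp (2 * X - 1)) (by
      have hd : (2 * X - 1 : ℝ[X]).natDegree ≤ 1 := by compute_degree
      refine natDegree_comp_le.trans ?_
      rw [natDegree_X_pow]
      nlinarith)
    rw [indicator_eval_comp_eq_twoPiece] at h1
    convert h1 using 2
    rw [X_pow_comp, neg_pow (X : ℝ[X]), C_pow, C_neg, C_1]
  -- By induction on `s`: modulo polynomials, `h^n_s` is a nonzero multiple of `sgn(u) u^s` plus a
  -- combination of `sgn(u) u^k` with `k < s`.
  have hS : ∀ s ≤ n, twoPiece (C ((-1) ^ (s + 1)) * X ^ s) (X ^ s) ∈ A := by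
    intro s
    induction s using Nat.strong_induction_on with
    | _ s ih =>
      intro hs
      set R := rightPoly n s
      have hc : R.coeff s ≠ 0 := left_ne_zero_of_mul_eq_one (coeff_mul_ip_rightPoly_X_pow hs)
      have hR : R = ∑ k ∈ range (n + 1), C (R.coeff k) * X ^ k :=
        as_sum_range_C_mul_X_pow' _ (Nat.lt_succ_of_le (natDegree_rightPoly_le hs))
      have h1 : psi n s = ∑ k ∈ range (n + 1),
          R.coeff k • twoPiece (C ((-1) ^ (s + 1)) * X ^ k) (X ^ k) := by
        rw [← hlin, psi_eq_twoPiece]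
        congr 1
        conv_lhs => rw [show rightPoly n s = R from rfl, hR, mul_sum]
        exact sum_congr rfl fun k _ => by ring
      rw [← add_sum_erase _ _ (mem_range.2 (Nat.lt_succ_of_le hs))] at h1
      have h2 : ∑ k ∈ (range (n + 1)).erase s,
          R.coeff k • twoPiece (C ((-1) ^ (s + 1)) * X ^ k) (X ^ k) ∈ A := by
        refine A.sum_mem fun k hk => ?_
        have hk1 : k ≠ s := ne_of_mem_erase hk
        have hk2 : k ≤ n := Nat.lt_succ_iff.1 (mem_range.1 (mem_of_mem_erase hk))
        rcases Nat.even_or_odd (k + s) with he | ho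
        · rcases lt_or_gt_of_ne hk1 with hlt | hgt
          · refine A.smul_mem _ ?_
            have : (-1 : ℝ) ^ (s + 1) = (-1) ^ (k + 1) :=
              neg_one_pow_congr (by rw [Nat.even_iff] at he; simp only [Nat.even_iff]; omega)
            rw [this]
            exact ih k hlt hk2
          · rw [coeff_rightPoly_eq_zero hs hgt he, zero_smul]
            exact A.zero_mem
        · refine A.smul_mem _ ?_
          have : (-1 : ℝ) ^ (s + 1) = (-1) ^ k :=
            neg_one_pow_congr (by rw [Nat.odd_iff] at ho; simp only [Nat.even_iff]; omega)
          rw [this]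
          exact hX k hk2
      have h3 := A.sub_mem (hpsi s hs) h2
      rw [h1, add_sub_cancel_right] at h3
      exact (A.smul_mem_iff hc).1 h3
  have hgen : ∀ s ≤ n, ∀ a b : ℝ, twoPiece (C a * X ^ s) (C b * X ^ s) ∈ A := by
    intro s hs a b
    have h1 : twoPiece (C a * X ^ s) (C b * X ^ s) =
        ((b + (-1) ^ s * a) / 2) • twoPiece (C ((-1) ^ s) * X ^ s) (X ^ s) +
        ((b - (-1) ^ s * a) / 2) • twoPiece (C ((-1) ^ (s + 1)) * X ^ s) (X ^ s) := by
      have h2 : (-1 : ℝ) ^ s * (-1) ^ s = 1 := by rw [← mul_pow]; simp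
      funext t
      simp only [twoPiece, Pi.add_apply, Pi.smul_apply, smul_eq_mul, Set.indicator_apply]
      split_ifs
      · simp only [eval_mul, eval_C, eval_pow, eval_X, pow_succ (-1 : ℝ) s]
        linear_combination (-a * (1 - 2 * t) ^ s) * h2
      · simp only [eval_mul, eval_C, eval_pow, eval_X]
        ring
      · simp
    rw [h1]
    exact A.add_mem (A.smul_mem _ (hX s hs)) (A.smul_mem _ (hS s hs))
  have h1 := hlin ℕ (range (n + 1)) (fun _ => 1) (fun k => C (p.coeff k) * X ^ k)
    (fun k => C (q.coeff k) * X ^ k)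
  simp only [C_1, one_mul, one_smul] at h1
  rw [← as_sum_range_C_mul_X_pow' _ (Nat.lt_succ_of_le hp),
    ← as_sum_range_C_mul_X_pow' _ (Nat.lt_succ_of_le hq)] at h1
  rw [h1]
  exact A.sum_mem fun k hk => hgen k (Nat.lt_succ_iff.1 (mem_range.1 hk)) _ _

/-! ### Dyadic intervals and orthonormality -/

/-- The dyadic interval `[i/2^k, (i+1)/2^k)`. -/
def dyadic (k i : ℕ) : Set ℝ := Set.Ico (i / 2 ^ k) ((i + 1) / 2 ^ k)

theorem mem_dyadic {k i : ℕ} {t : ℝ} : t ∈ dyadic k i ↔ 2 ^ k * t - i ∈ Set.Ico (0 : ℝ) 1 := by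
  have h2 : (0 : ℝ) < 2 ^ k := by positivity
  rw [dyadic, Set.mem_Ico, Set.mem_Ico, div_le_iff₀ h2, lt_div_iff₀ h2]
  constructor <;> rintro ⟨h1, h3⟩ <;> constructor <;> linarith

theorem mem_dyadic_iff_floor {k i : ℕ} {t : ℝ} (ht : 0 ≤ t) :
    t ∈ dyadic k i ↔ ⌊2 ^ k * t⌋₊ = i := by
  rw [Nat.floor_eq_iff (by positivity), mem_dyadic, Set.mem_Ico]
  constructor <;> rintro ⟨h1, h3⟩ <;> constructor <;> linarith

theorem nonneg_of_mem_dyadic {k i : ℕ} {t : ℝ} (ht : t ∈ dyadic k i) : 0 ≤ t :=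
  le_trans (by positivity) ht.1

theorem measurableSet_dyadic (k i : ℕ) : MeasurableSet (dyadic k i) := measurableSet_Ico

theorem dyadic_subset_Ico {k i : ℕ} (hi : i < 2 ^ k) : dyadic k i ⊆ Set.Ico 0 1 := by
  intro t ht
  refine ⟨nonneg_of_mem_dyadic ht, ht.2.trans_le ?_⟩
  rw [div_le_one (by positivity)]
  exact_mod_cast hi

theorem dyadic_subset_dyadic (k d i : ℕ) : dyadic (k + d) i ⊆ dyadic k (i / 2 ^ d) := by
  intro t ht
  have h0 := nonneg_of_mem_dyadic ht
  rw [mem_dyadic_iff_floor h0] at ht ⊢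
  rw [← ht, ← Nat.floor_div_natCast]
  congr 1
  push_cast
  rw [pow_add]
  field_simp

/-- `f` agrees on `s` with a polynomial of degree at most `n`. -/
def IsPolyOn (n : ℕ) (s : Set ℝ) (f : ℝ → ℝ) : Prop :=
  ∃ p : ℝ[X], p.natDegree ≤ n ∧ ∀ t ∈ s, f t = p.eval t

theorem IsPolyOn.mono {n : ℕ} {s s' : Set ℝ} {f : ℝ → ℝ} (h : IsPolyOn n s f) (hs : s' ⊆ s) :
    IsPolyOn n s' f :=
  let ⟨p, hp, hf⟩ := h
  ⟨p, hp, fun t ht => hf t (hs ht)⟩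

theorem natDegree_C_mul_comp_affine_le {n : ℕ} {P : ℝ[X]} (hP : P.natDegree ≤ n) (c a b : ℝ) :
    (C c * P.comp (C a * X + C b)).natDegree ≤ n := by
  have hd : (C a * X + C b : ℝ[X]).natDegree ≤ 1 := by compute_degree
  exact (natDegree_C_mul_le _ _).trans (natDegree_comp_le.trans (by nlinarith))

theorem isPolyOn_twoPiece_comp {n : ℕ} {A B : ℝ[X]} (hA : A.natDegree ≤ n) (hB : B.natDegree ≤ n)
    (c : ℝ) (k i m : ℕ) :
    IsPolyOn n (dyadic (k + 1) m) (fun t => c * twoPiece A B (2 ^ k * t - i)) := by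
  have key : ∀ t ∈ dyadic (k + 1) m,
      (m : ℝ) ≤ 2 * (2 ^ k * t) ∧ 2 * (2 ^ k * t) < m + 1 := by
    intro t ht
    rw [mem_dyadic, pow_succ] at ht
    exact ⟨by linarith [ht.1], by linarith [ht.2]⟩
  rcases lt_or_ge m (2 * i) with h1 | h1
  · refine ⟨0, by simp, fun t ht => ?_⟩
    have h2 : (m : ℝ) + 1 ≤ 2 * i := by exact_mod_cast h1
    dsimp only
    rw [twoPiece_of_notMem, mul_zero, eval_zero]
    rintro ⟨h3, -⟩
    linarith [(key t ht).2]
  rcases eq_or_lt_of_le h1 with h1 | h1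
  · refine ⟨C c * A.comp (C (-2 * 2 ^ k) * X + C (1 + 2 * (i : ℝ))),
      natDegree_C_mul_comp_affine_le hA _ _ _, fun t ht => ?_⟩
    have h2 : (m : ℝ) = 2 * i := by exact_mod_cast h1.symm
    obtain ⟨h3, h4⟩ := key t ht
    dsimp only
    rw [twoPiece_of_lt _ _ (by linarith) (by linarith)]
    simp only [eval_mul, eval_comp, eval_C, eval_add, eval_X]
    ring_nf
  rcases eq_or_lt_of_le (Nat.succ_le_of_lt h1) with h1 | h1
  · refine ⟨C c * B.comp (C (2 * 2 ^ k) * X + C (-2 * (i : ℝ) - 1)),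
      natDegree_C_mul_comp_affine_le hB _ _ _, fun t ht => ?_⟩
    have h2 : (m : ℝ) = 2 * i + 1 := by exact_mod_cast h1.symm
    obtain ⟨h3, h4⟩ := key t ht
    dsimp only
    rw [twoPiece_of_ge _ _ (by linarith) (by linarith)]
    simp only [eval_mul, eval_comp, eval_C, eval_add, eval_X]
    ring_nf
  · refine ⟨0, by simp, fun t ht => ?_⟩
    have h2 : (2 * i : ℝ) + 2 ≤ m := by exact_mod_cast h1
    dsimp only
    rw [twoPiece_of_notMem, mul_zero, eval_zero]
    rintro ⟨-, h3⟩
    linarith [(key t ht).1]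

theorem isPolyOn_psi_comp {n j : ℕ} (hj : j ≤ n) (c : ℝ) (k i m : ℕ) :
    IsPolyOn n (dyadic (k + 1) m) (fun t => c * psi n j (2 ^ k * t - i)) := by
  rw [psi_eq_twoPiece]
  exact isPolyOn_twoPiece_comp
    ((natDegree_C_mul_le _ _).trans (natDegree_rightPoly_le hj)) (natDegree_rightPoly_le hj) c k i m

/-- The level of dyadic subdivision from which on the member of the family is a single polynomial on
every interval. -/
def level {n : ℕ} : Index n → ℕ
  | Sum.inl _ => 0
  | Sum.inr ⟨k, _, _⟩ => k + 1

theorem family_inl (n : ℕ) (j : Fin (n + 1)) :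
    family n (Sum.inl j) = (Set.Ico 0 1).indicator fun t => (rightPoly j j).eval t := by
  funext t
  simp only [family, phi, Set.indicator_apply]
  split_ifs
  · exact sqrt_two_mul_legendreHat j t
  · simp

theorem isPolyOn_family {n : ℕ} (a : Index n) {k i : ℕ} (hk : level a ≤ k) (hi : i < 2 ^ k) :
    IsPolyOn n (dyadic k i) (family n a) := by
  obtain j | ⟨k', i', j⟩ := a
  · refine ⟨rightPoly j j, (natDegree_rightPoly_le le_rfl).trans (Nat.lt_succ_iff.1 j.2),
      fun t ht => ?_⟩
    rw [family_inl, Set.indicator_of_mem (dyadic_subset_Ico hi ht)]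
  · obtain ⟨d, rfl⟩ := Nat.exists_eq_add_of_le hk
    exact (isPolyOn_psi_comp (Nat.lt_succ_iff.1 j.2) _ k' i' _).mono (dyadic_subset_dyadic _ d i)

theorem isPiecewisePolynomial_family {n : ℕ} (a : Index n) :
    IsPiecewisePolynomial n (family n a) := by
  refine ⟨2 ^ level a, fun m => (m : ℕ) / 2 ^ level a, fun m m' hm => ?_, by simp, by simp,
    fun m => ?_⟩
  · have : ((m : ℕ) : ℝ) < ((m' : ℕ) : ℝ) := by exact_mod_cast hm
    dsimp only
    gcongr
  · obtain ⟨p, hp, h⟩ := isPolyOn_family a le_rfl m.2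
    exact ⟨p, hp, fun t ht => h t (by simpa [dyadic] using ht)⟩

theorem setIntegral_indicator_comp {k i : ℕ} (hi : i < 2 ^ k) (g : ℝ → ℝ) :
    ∫ t in Set.Ico 0 1, (Set.Ico 0 1).indicator g (2 ^ k * t - i) =
      (2 ^ k)⁻¹ * ∫ u in Set.Ico 0 1, g u := by
  rw [setIntegral_eq_integral_of_forall_compl_eq_zero,
    Measure.integral_comp_mul_left (fun u => (Set.Ico 0 1).indicator g (u - i)),
    integral_sub_right_eq_self, integral_indicator measurableSet_Ico, smul_eq_mul,
    abs_of_pos (by positivity)]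
  intro t ht
  exact Set.indicator_of_notMem (fun h => ht (dyadic_subset_Ico hi (mem_dyadic.2 h))) _

theorem setIntegral_mul_wavelet_of_isPolyOn {n k i j : ℕ} {f : ℝ → ℝ} (hi : i < 2 ^ k) (hj : j ≤ n)
    (hf : IsPolyOn n (dyadic k i) f) (c : ℝ) :
    ∫ t in Set.Ico 0 1, f t * (c * psi n j (2 ^ k * t - i)) = 0 := by
  obtain ⟨p, hp, h⟩ := hf
  set q : ℝ[X] := C c * p.comp (C (2 ^ k : ℝ)⁻¹ * X + C ((2 ^ k : ℝ)⁻¹ * i))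
  have hq : q.natDegree ≤ n := natDegree_C_mul_comp_affine_le hp _ _ _
  have h1 : ∀ t, f t * (c * psi n j (2 ^ k * t - i)) =
      (Set.Ico 0 1).indicator (fun u => q.eval u * psi n j u) (2 ^ k * t - i) := by
    intro t
    by_cases ht : t ∈ dyadic k i
    · rw [Set.indicator_of_mem (mem_dyadic.1 ht), h t ht]
      simp only [q, eval_mul, eval_comp, eval_C, eval_add, eval_X]
      rw [show (2 ^ k : ℝ)⁻¹ * (2 ^ k * t - i) + (2 ^ k)⁻¹ * i = t by field_simp; ring]
      ring
    · rw [mem_dyadic] at ht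
      rw [Set.indicator_of_notMem ht, psi, Set.indicator_of_notMem ht]
      simp
  simp_rw [h1]
  rw [setIntegral_indicator_comp hi, setIntegral_eval_mul_psi hj hq, mul_zero]

theorem setIntegral_wavelet_mul_wavelet {n k i i' j j' : ℕ} (hi : i < 2 ^ k)
    (hj : j ≤ n) (hj' : j' ≤ n) :
    ∫ t in Set.Ico 0 1, ((2 : ℝ) ^ ((k : ℝ) / 2) * psi n j (2 ^ k * t - i)) *
      ((2 : ℝ) ^ ((k : ℝ) / 2) * psi n j' (2 ^ k * t - i')) =
      if i = i' ∧ j = j' then 1 else 0 := by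
  have hc : (2 : ℝ) ^ ((k : ℝ) / 2) * (2 : ℝ) ^ ((k : ℝ) / 2) = 2 ^ k := by
    rw [← Real.rpow_add two_pos, add_halves, Real.rpow_natCast]
  by_cases hii : i = i'
  · subst hii
    have h1 : ∀ t : ℝ, ((2 : ℝ) ^ ((k : ℝ) / 2) * psi n j (2 ^ k * t - i)) *
        ((2 : ℝ) ^ ((k : ℝ) / 2) * psi n j' (2 ^ k * t - i)) =
        2 ^ k * (Set.Ico 0 1).indicator (fun u => psi n j u * psi n j' u) (2 ^ k * t - i) := by
      intro t
      by_cases ht : 2 ^ k * t - (i : ℝ) ∈ Set.Ico (0 : ℝ) 1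
      · rw [Set.indicator_of_mem ht]
        linear_combination psi n j (2 ^ k * t - i) * psi n j' (2 ^ k * t - i) * hc
      · rw [psi, Set.indicator_of_notMem ht, Set.indicator_of_notMem ht]
        simp
    simp_rw [h1]
    rw [integral_const_mul, setIntegral_indicator_comp hi, setIntegral_psi_mul_psi hj hj']
    simp
  · rw [if_neg (fun h => hii h.1)]
    refine integral_eq_zero_of_ae (Filter.Eventually.of_forall fun t => ?_)
    by_cases ht : t ∈ dyadic k i
    · have ht' : t ∉ dyadic k i' := fun ht' => by
        have h0 := nonneg_of_mem_dyadic ht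
        rw [mem_dyadic_iff_floor h0] at ht ht'
        exact hii (ht.symm.trans ht')
      rw [mem_dyadic] at ht'
      simp only [psi, Set.indicator_of_notMem ht', mul_zero, Pi.zero_apply]
    · rw [mem_dyadic] at ht
      simp only [psi, Set.indicator_of_notMem ht, mul_zero, zero_mul, Pi.zero_apply]

theorem setIntegral_family_inl_mul_family_inl {n : ℕ} (j j' : Fin (n + 1)) :
    ∫ t in Set.Ico 0 1, family n (Sum.inl j) t * family n (Sum.inl j') t =
      if j = j' then 1 else 0 := by
  have h1 : ∫ t in Set.Ico 0 1, family n (Sum.inl j) t * family n (Sum.inl j') t =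
      ip (rightPoly j j) (rightPoly j' j') := by
    rw [ip, intervalIntegral.integral_of_le zero_le_one, ← integral_Ico_eq_integral_Ioc]
    refine setIntegral_congr_fun measurableSet_Ico fun t ht => ?_
    simp only [family_inl, Set.indicator_of_mem ht]
  rw [h1]
  clear h1
  wlog hle : j' ≤ j generalizing j j'
  · rw [ip_comm, this j' j (by omega)]
    simp only [eq_comm]
  split_ifs with h
  · subst h
    rw [ip_rightPoly le_rfl le_rfl (Even.add_self _), if_pos rfl]
  · have hlt : (j' : ℕ) < j := lt_of_le_of_ne hle fun h' => h (Fin.ext h'.symm)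
    rw [ip_eq_sum _ (natDegree_rightPoly_le le_rfl)]
    refine sum_eq_zero fun s hs => ?_
    rw [ip_rightPoly_X_pow_of_lt le_rfl (by have := mem_range.1 hs; omega), mul_zero]

/-- Of two members of different level, the coarser one is a polynomial on the support of the finer
one. -/
theorem setIntegral_family_mul_family {n : ℕ} (a b : Index n) :
    ∫ t in Set.Ico 0 1, family n a t * family n b t = if a = b then 1 else 0 := by
  wlog hle : level a ≤ level b generalizing a b
  · simp_rw [mul_comm (family n a _)]
    rw [this b a (by omega)]
    simp only [eq_comm]
  obtain j' | ⟨k, i, j⟩ := b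
  · obtain j | ⟨k, i, j⟩ := a
    · rw [setIntegral_family_inl_mul_family_inl]
      simp
    · simp [level] at hle
  · rcases Nat.lt_or_ge k (level a) with hlt | hge
    · obtain j' | ⟨k', i', j'⟩ := a
      · simp [level] at hlt
      · obtain rfl : k' = k := by simp only [level] at hle hlt; omega
        have := setIntegral_wavelet_mul_wavelet (n := n) (k := k') (i := i') (i' := i) (j := j')
          (j' := j) i'.2 (Nat.lt_succ_iff.1 j'.2) (Nat.lt_succ_iff.1 j.2)
        rw [show (∫ t in Set.Ico 0 1, family n (Sum.inr ⟨k', i', j'⟩) t *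
          family n (Sum.inr ⟨k', i, j⟩) t) = _ from this]
        refine if_congr ?_ rfl rfl
        simp [Fin.ext_iff]
    · rw [if_neg (by rintro rfl; simp [level] at hge)]
      exact setIntegral_mul_wavelet_of_isPolyOn i.2 (Nat.lt_succ_iff.1 j.2)
        (isPolyOn_family a hge i.2) _

/-! ### Completeness -/

theorem measurable_twoPiece (A B : ℝ[X]) : Measurable (twoPiece A B) := by
  refine Measurable.indicator (Measurable.ite measurableSet_Iio ?_ ?_) measurableSet_Ico
  · exact Continuous.measurable (by fun_prop)
  · exact Continuous.measurable (by fun_prop)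

theorem exists_abs_twoPiece_le (A B : ℝ[X]) : ∃ K, ∀ t, |twoPiece A B t| ≤ K := by
  obtain ⟨a, ha⟩ := isCompact_Icc.exists_bound_of_continuousOn (s := Set.Icc (0 : ℝ) 1)
    (f := fun t => A.eval t) (by fun_prop)
  obtain ⟨b, hb⟩ := isCompact_Icc.exists_bound_of_continuousOn (s := Set.Icc (0 : ℝ) 1)
    (f := fun t => B.eval t) (by fun_prop)
  have ha0 : 0 ≤ a := (norm_nonneg _).trans (ha 0 (by simp))
  refine ⟨max a b, fun t => ?_⟩
  by_cases ht : t ∈ Set.Ico (0 : ℝ) 1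
  · rcases lt_or_ge t (1 / 2) with h1 | h1
    · rw [twoPiece_of_lt _ _ ht.1 h1]
      exact (ha _ ⟨by linarith, by linarith [ht.1]⟩).trans (le_max_left _ _)
    · rw [twoPiece_of_ge _ _ h1 ht.2]
      exact (hb _ ⟨by linarith, by linarith [ht.2]⟩).trans (le_max_right _ _)
  · rw [twoPiece_of_notMem _ _ ht, abs_zero]
    exact ha0.trans (le_max_left _ _)

theorem exists_family_eq {n : ℕ} (a : Index n) : ∃ (c : ℝ) (A B : ℝ[X]) (k i : ℕ),
    family n a = fun t => c * twoPiece A B (2 ^ k * t - i) := by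
  obtain j | ⟨k, i, j⟩ := a
  · rw [family_inl, indicator_eval_eq_twoPiece]
    refine ⟨1, ((rightPoly j j).comp (C (1 / 2) * (1 + X))).comp (-X),
      (rightPoly j j).comp (C (1 / 2) * (1 + X)), 0, 0, ?_⟩
    simp only [one_mul, pow_zero, Nat.cast_zero, sub_zero]
  · exact ⟨_, _, _, k, i, by rw [← psi_eq_twoPiece]; rfl⟩

section Scalars

variable {𝕜 : Type*} [RCLike 𝕜]

theorem memLp_family {n : ℕ} (a : Index n) :
    MemLp (fun t => ((family n a t : ℝ) : 𝕜)) 2 unitMeasure := by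
  obtain ⟨c, A, B, k, i, h⟩ := exists_family_eq a
  obtain ⟨K, hK⟩ := exists_abs_twoPiece_le A B
  rw [h]
  have hm := measurable_twoPiece A B
  refine MemLp.of_bound (C := |c| * K) (Measurable.aestronglyMeasurable (by fun_prop))
    (Filter.Eventually.of_forall fun t => ?_)
  rw [RCLike.norm_ofReal, abs_mul]
  exact mul_le_mul_of_nonneg_left (hK _) (abs_nonneg c)

variable (𝕜) in
/-- The members of the family as vectors of `L²[0,1)`. -/
def familyLp {n : ℕ} (a : Index n) : Lp 𝕜 2 unitMeasure := (memLp_family a).toLp _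

theorem orthonormal_familyLp (n : ℕ) : Orthonormal 𝕜 (familyLp 𝕜 : Index n → _) := by
  rw [orthonormal_iff_ite]
  intro a b
  have h1 : inner 𝕜 (familyLp 𝕜 a) (familyLp 𝕜 b) =
      ∫ t in Set.Ico 0 1, ((family n a t * family n b t : ℝ) : 𝕜) := by
    rw [L2.inner_def]
    refine integral_congr_ae ?_
    filter_upwards [(memLp_family (𝕜 := 𝕜) a).coeFn_toLp,
      (memLp_family (𝕜 := 𝕜) b).coeFn_toLp] with t ha hb
    rw [familyLp, familyLp, ha, hb, RCLike.inner_apply, RCLike.conj_ofReal, RCLike.ofReal_mul,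
      mul_comm]
  rw [h1, integral_ofReal, setIntegral_family_mul_family]
  split_ifs <;> simp

/-- The functions `g` whose copy `g(2^k · - i)` is orthogonal to `f` on `[0,1)`; integrability of the
product is demanded to make this a submodule. -/
def annihilator (f : ℝ → 𝕜) (k i : ℕ) : Submodule ℝ (ℝ → ℝ) where
  carrier := {g | Integrable (fun t => ((g (2 ^ k * t - i) : ℝ) : 𝕜) * f t) unitMeasure ∧
    ∫ t in Set.Ico 0 1, ((g (2 ^ k * t - i) : ℝ) : 𝕜) * f t = 0}
  zero_mem' := by simp
  add_mem' := by
    rintro g g' ⟨h1, h2⟩ ⟨h1', h2'⟩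
    simp only [Set.mem_ofPred_eq, Pi.add_apply, RCLike.ofReal_add, add_mul]
    exact ⟨h1.add h1', by rw [integral_add h1 h1', h2, h2', add_zero]⟩
  smul_mem' := by
    rintro c g ⟨h1, h2⟩
    simp only [Set.mem_ofPred_eq, Pi.smul_apply, smul_eq_mul, RCLike.ofReal_mul, mul_assoc]
    exact ⟨h1.const_mul _, by rw [integral_const_mul, h2, mul_zero]⟩

theorem twoPiece_mem_annihilator {f : ℝ → 𝕜} (hf : Integrable f unitMeasure) {A B : ℝ[X]}
    {k i : ℕ}
    (h : ∫ t in Set.Ico 0 1, ((twoPiece A B (2 ^ k * t - i) : ℝ) : 𝕜) * f t = 0) :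
    twoPiece A B ∈ annihilator f k i := by
  refine ⟨?_, h⟩
  obtain ⟨K, hK⟩ := exists_abs_twoPiece_le A B
  have hm := measurable_twoPiece A B
  refine hf.bdd_mul (c := K) (Measurable.aestronglyMeasurable (by fun_prop))
    (Filter.Eventually.of_forall fun t => ?_)
  rw [RCLike.norm_ofReal]
  exact hK _

/-- The Legendre polynomials of degree at most `n` span the polynomials of degree at most `n`. -/
theorem indicator_eval_mem_of_legendre_mem {n : ℕ} {A : Submodule ℝ (ℝ → ℝ)}
    (h : ∀ j ≤ n, (Set.Ico 0 1).indicator (fun t => (rightPoly j j).eval t) ∈ A)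
    {q : ℝ[X]} (hq : q.natDegree ≤ n) : (Set.Ico 0 1).indicator (fun t => q.eval t) ∈ A := by
  have hsum : ∀ (m : ℕ) (p : ℝ[X]), p.natDegree ≤ m →
      (Set.Ico 0 1).indicator (fun t => p.eval t) =
        ∑ s ∈ range (m + 1), p.coeff s • (Set.Ico (0 : ℝ) 1).indicator (fun t => t ^ s) := by
    intro m p hp
    funext t
    simp only [Finset.sum_apply, Pi.smul_apply, smul_eq_mul, Set.indicator_apply]
    split_ifs
    · rw [eval_eq_sum_range' (Nat.lt_succ_of_le hp)]
    · simp
  have hX : ∀ s ≤ n, (Set.Ico (0 : ℝ) 1).indicator (fun t => t ^ s) ∈ A := by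
    intro s
    induction s using Nat.strong_induction_on with
    | _ s ih =>
      intro hs
      have h1 := h s hs
      rw [hsum s _ (natDegree_rightPoly_le le_rfl), sum_range_succ] at h1
      have h2 := A.sum_mem (t := range s) (f := fun m => (rightPoly s s).coeff m •
        (Set.Ico (0 : ℝ) 1).indicator (fun t => t ^ m)) fun m hm =>
        A.smul_mem _ (ih m (mem_range.1 hm) ((mem_range.1 hm).le.trans hs))
      exact (A.smul_mem_iff (left_ne_zero_of_mul_eq_one (coeff_mul_ip_rightPoly_X_pow le_rfl))).1
        ((A.add_mem_iff_right h2).1 h1)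
  rw [hsum n q hq]
  exact A.sum_mem fun s hs => A.smul_mem _ (hX s (Nat.lt_succ_iff.1 (mem_range.1 hs)))

/-- By induction on the level: if `f` is orthogonal to the polynomials on a dyadic interval and to the
wavelets living there, it is orthogonal to the polynomials on both halves. -/
theorem indicator_eval_mem_annihilator {n : ℕ} {f : ℝ → 𝕜} (hf : Integrable f unitMeasure)
    (horth : ∀ a : Index n, ∫ t in Set.Ico 0 1, ((family n a t : ℝ) : 𝕜) * f t = 0)
    {k i : ℕ} (hi : i < 2 ^ k) {q : ℝ[X]} (hq : q.natDegree ≤ n) :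
    (Set.Ico 0 1).indicator (fun t => q.eval t) ∈ annihilator f k i := by
  induction k generalizing i q with
  | zero =>
    obtain rfl : i = 0 := by simpa using hi
    refine indicator_eval_mem_of_legendre_mem (fun j hj => ?_) hq
    rw [indicator_eval_eq_twoPiece]
    refine twoPiece_mem_annihilator hf ?_
    rw [← indicator_eval_eq_twoPiece]
    have h1 := horth (Sum.inl ⟨j, Nat.lt_succ_of_le hj⟩)
    rw [family_inl] at h1
    simpa using h1
  | succ k ih =>
    have hi2 : i / 2 < 2 ^ k := by rw [pow_succ] at hi; omega
    have hpsi : ∀ j ≤ n, psi n j ∈ annihilator f k (i / 2) := by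
      intro j hj
      rw [psi_eq_twoPiece]
      refine twoPiece_mem_annihilator hf ?_
      rw [← psi_eq_twoPiece]
      have h1 := horth (Sum.inr ⟨k, ⟨i / 2, hi2⟩, ⟨j, Nat.lt_succ_of_le hj⟩⟩)
      simp only [family, RCLike.ofReal_mul, mul_assoc] at h1
      rw [integral_const_mul] at h1
      refine (mul_eq_zero.1 h1).resolve_left ?_
      exact RCLike.ofReal_ne_zero.2 (by positivity)
    have hmem : ∀ P Q : ℝ[X], P.natDegree ≤ n → Q.natDegree ≤ n →
        twoPiece P Q ∈ annihilator f k (i / 2) :=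
      fun P Q hP hQ => twoPiece_mem (fun q hq => ih hi2 hq) hpsi hP hQ
    rw [indicator_eval_eq_twoPiece]
    refine twoPiece_mem_annihilator hf ?_
    rw [← indicator_eval_eq_twoPiece]
    -- A polynomial on a half of the parent interval is a two-piece polynomial on the parent.
    obtain ⟨P, Q, hP, hQ, h⟩ : ∃ P Q : ℝ[X], P.natDegree ≤ n ∧ Q.natDegree ≤ n ∧
        ∀ t : ℝ, (Set.Ico 0 1).indicator (fun t => q.eval t) (2 ^ (k + 1) * t - i) =
          twoPiece P Q (2 ^ k * t - (i / 2 : ℕ)) := by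
      rcases Nat.even_or_odd' i with ⟨m, rfl | rfl⟩
      · refine ⟨q.comp (1 - X), 0, ?_, by simp, fun t => ?_⟩
        · have hd : (1 - X : ℝ[X]).natDegree ≤ 1 := by compute_degree
          exact natDegree_comp_le.trans (by nlinarith)
        · rw [show 2 * m / 2 = m by omega,
            show (2 : ℝ) ^ (k + 1) * t - (2 * m : ℕ) = 2 * (2 ^ k * t - m) by push_cast; ring]
          generalize (2 : ℝ) ^ k * t - m = u
          by_cases hu : 2 * u ∈ Set.Ico (0 : ℝ) 1
          · rw [Set.indicator_of_mem hu, twoPiece_of_lt _ _ (by linarith [hu.1])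
              (by linarith [hu.2])]
            simp
          · rw [Set.indicator_of_notMem hu]
            by_cases hu' : u ∈ Set.Ico (0 : ℝ) 1
            · rw [twoPiece_of_ge _ _ (not_lt.1 fun h1 => hu ⟨by linarith [hu'.1], by linarith⟩)
                hu'.2, eval_zero]
            · rw [twoPiece_of_notMem _ _ hu']
      · refine ⟨0, q, by simp, hq, fun t => ?_⟩
        rw [show (2 * m + 1) / 2 = m by omega,
          show (2 : ℝ) ^ (k + 1) * t - (2 * m + 1 : ℕ) = 2 * (2 ^ k * t - m) - 1 by
            push_cast; ring]
        generalize (2 : ℝ) ^ k * t - m = u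
        by_cases hu : 2 * u - 1 ∈ Set.Ico (0 : ℝ) 1
        · rw [Set.indicator_of_mem hu, twoPiece_of_ge _ _ (by linarith [hu.1])
            (by linarith [hu.2])]
        · rw [Set.indicator_of_notMem hu]
          by_cases hu' : u ∈ Set.Ico (0 : ℝ) 1
          · rw [twoPiece_of_lt _ _ hu'.1
              (not_le.1 fun h1 => hu ⟨by linarith, by linarith [hu'.2]⟩), eval_zero]
          · rw [twoPiece_of_notMem _ _ hu']
    simp_rw [h]
    exact (hmem P Q hP hQ).2

/-- The primitive of `f` vanishes at the dyadic points, hence everywhere by continuity, and its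
derivative is almost everywhere `f`. -/
theorem ae_eq_zero_of_forall_dyadic {f : ℝ → 𝕜} (hf : Integrable f unitMeasure)
    (h : ∀ k i, i < 2 ^ k → ∫ t in dyadic k i, f t = 0) : f =ᵐ[unitMeasure] 0 := by
  have hint : IntegrableOn f (Set.uIcc 0 1) := by
    rw [Set.uIcc_of_le zero_le_one, integrableOn_Icc_iff_integrableOn_Ico]
    exact hf
  have hcont := intervalIntegral.continuousOn_primitive_interval hint
  have hsub : ∀ x y : ℝ, x ∈ Set.Icc (0 : ℝ) 1 → y ∈ Set.Icc (0 : ℝ) 1 →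
      IntervalIntegrable f volume x y := fun x y hx hy =>
    (hint.mono_set (by
      rw [Set.uIcc_of_le (zero_le_one' ℝ)]
      exact Set.uIcc_subset_Icc hx hy)).intervalIntegrable
  have hmem : ∀ k i : ℕ, i ≤ 2 ^ k → (i / 2 ^ k : ℝ) ∈ Set.Icc (0 : ℝ) 1 := fun k i hi =>
    ⟨by positivity, by rw [div_le_one (by positivity)]; exact_mod_cast hi⟩
  have hdy : ∀ k i : ℕ, i ≤ 2 ^ k → ∫ t in (0 : ℝ)..(i / 2 ^ k), f t = 0 := by
    intro k i
    induction i with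
    | zero => simp
    | succ i ih =>
      intro hi
      rw [← intervalIntegral.integral_add_adjacent_intervals
        (hsub 0 (i / 2 ^ k) (by simp) (hmem k i (by omega)))
        (hsub _ _ (hmem k i (by omega)) (hmem k (i + 1) hi)), ih (by omega), zero_add,
        intervalIntegral.integral_of_le (by gcongr; simp), ← integral_Ico_eq_integral_Ioc]
      have := h k i hi
      rw [dyadic] at this
      push_cast
      exact this
  have hzero : ∀ x ∈ Set.Ioo (0 : ℝ) 1, ∫ t in (0 : ℝ)..x, f t = 0 := by
    intro x hx
    have hle : ∀ k : ℕ, ⌊x * 2 ^ k⌋₊ ≤ 2 ^ k := fun k => by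
      have h1 : x * 2 ^ k ≤ ((2 ^ k : ℕ) : ℝ) := by
        push_cast
        exact mul_le_of_le_one_left (by positivity) hx.2.le
      exact Nat.floor_le_of_le h1
    have ht : Filter.Tendsto (fun k : ℕ => (⌊x * 2 ^ k⌋₊ / 2 ^ k : ℝ)) Filter.atTop
        (nhdsWithin x (Set.uIcc 0 1)) := by
      refine tendsto_nhdsWithin_iff.2 ⟨(tendsto_nat_floor_mul_div_atTop hx.1.le).comp
        (tendsto_pow_atTop_atTop_of_one_lt one_lt_two), Filter.Eventually.of_forall fun k => ?_⟩
      rw [Set.uIcc_of_le zero_le_one]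
      exact hmem k _ (hle k)
    have h1 := (hcont x (by rw [Set.uIcc_of_le zero_le_one]; exact ⟨hx.1.le, hx.2.le⟩)).tendsto.comp
      ht
    refine tendsto_nhds_unique h1 ?_
    simp only [Function.comp_def, hdy _ _ (hle _)]
    exact tendsto_const_nhds
  have hne : ∀ᵐ x : ℝ, x ≠ 0 := by simp [ae_iff, measure_singleton]
  rw [Filter.EventuallyEq, unitMeasure, ae_restrict_iff' measurableSet_Ico]
  filter_upwards [hint.intervalIntegrable.ae_hasDerivAt_integral, hne] with x hx hx0 hx1
  have hx2 : x ∈ Set.Ioo (0 : ℝ) 1 := ⟨lt_of_le_of_ne hx1.1 (Ne.symm hx0), hx1.2⟩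
  have h1 := hx (by rw [Set.uIcc_of_le zero_le_one]; exact ⟨hx1.1, hx1.2.le⟩) 0
    Set.left_mem_uIcc
  have h2 : HasDerivAt (fun x => ∫ t in (0 : ℝ)..x, f t) 0 x :=
    (hasDerivAt_const x (0 : 𝕜)).congr_of_eventuallyEq
      (Filter.eventually_of_mem (isOpen_Ioo.mem_nhds hx2) hzero)
  exact h1.unique h2

theorem span_familyLp_orthogonal (n : ℕ) :
    (Submodule.span 𝕜 (Set.range (familyLp 𝕜 : Index n → _)))ᗮ = ⊥ := by
  rw [Submodule.eq_bot_iff]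
  intro f hf
  have hint : Integrable f unitMeasure := (Lp.memLp f).integrable one_le_two
  have horth : ∀ a : Index n, ∫ t in Set.Ico 0 1, ((family n a t : ℝ) : 𝕜) * f t = 0 := by
    intro a
    have h1 := (Submodule.mem_orthogonal _ _).1 hf _ (Submodule.subset_span ⟨a, rfl⟩)
    rw [L2.inner_def] at h1
    rw [← h1]
    refine integral_congr_ae ?_
    filter_upwards [(memLp_family (𝕜 := 𝕜) a).coeFn_toLp] with t ha
    rw [familyLp, ha, RCLike.inner_apply, RCLike.conj_ofReal, mul_comm]
  refine (Lp.eq_zero_iff_ae_eq_zero).2 (ae_eq_zero_of_forall_dyadic hint fun k i hi => ?_)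
  have h1 := (indicator_eval_mem_annihilator hint horth hi (q := 1) (by simp)).2
  rw [← h1, ← integral_indicator (measurableSet_dyadic k i),
    ← integral_indicator measurableSet_Ico]
  refine integral_congr_ae (Filter.Eventually.of_forall fun t => ?_)
  by_cases ht : t ∈ dyadic k i
  · simp [Set.indicator_of_mem ht, Set.indicator_of_mem (dyadic_subset_Ico hi ht),
      Set.indicator_of_mem (mem_dyadic.1 ht)]
  · rw [Set.indicator_of_notMem ht, Set.indicator_apply]
    simp [Set.indicator_of_notMem (mt mem_dyadic.2 ht)]

end Scalars

end AlpertWavelet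
end

theorem theorem3 (𝕜 : Type*) [RCLike 𝕜] (n : ℕ) :
    (∀ a : AlpertWavelet.Index n,
      AlpertWavelet.IsPiecewisePolynomial n (AlpertWavelet.family n a)) ∧
    ∃ b : HilbertBasis (AlpertWavelet.Index n) 𝕜 (Lp 𝕜 2 AlpertWavelet.unitMeasure),
      ∀ a : AlpertWavelet.Index n,
        (b a : ℝ → 𝕜) =ᵐ[AlpertWavelet.unitMeasure]
          fun t => ((AlpertWavelet.family n a t : ℝ) : 𝕜) := by
  refine ⟨AlpertWavelet.isPiecewisePolynomial_family, HilbertBasis.mkOfOrthogonalEqBot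
    (AlpertWavelet.orthonormal_familyLp n) (AlpertWavelet.span_familyLp_orthogonal n),
    fun a => ?_⟩
  rw [HilbertBasis.coe_mkOfOrthogonalEqBot]
  exact (AlpertWavelet.memLp_family a).coeFn_toLp
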